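/- Let $K$ be a field with $\operatorname{char} K\neq 2$ and let $X$ be a connected partially ordered set (any two points are joined by a finite path whose consecutive points are comparable). Let $FI(X,K)$ be the finitary incidence algebra: the $K$-algebra of all $f:X\times X\to K$ with $f(x,y)=0$ if $x\not\leq y$ such that for all $x\leq y$ only finitely many subintervals $[u,v]\subseteq[x,y]$ satisfy $u\neq v$ and $f(u,v)\neq 0$, with product $(fg)(x,y)=\sum_{x\leq z\leq y}f(x,z)g(z,y)$. For an invertible element $u$ put $\Psi_u(f)=ufu^{-1}$. Assume that every multiplicative automorphism of $FI(X,K)$ is inner, i.e. for every $\sigma$ with $\sigma(x,y)\neq0$ for $x\leq y$ and $\sigma(x,y)\sigma(y,z)=\sigma(x,z)$ for $x\leq y\leq z$, the automorphism $M_\sigma(f)(x,y)=\sigma(x,y)f(x,y)$ equals some $\Psi_u$. An involution on a $K$-algebra is an additive, product-reversing map of square the identity; it is of the second kind if it is not the identity on the center. An involution on $X$ is a map $\lambda:X\to X$ with $\lambda^2=\mathrm{id}$ and $x\leq y\Leftrightarrow\lambda(y)\leq\lambda(x)$; put $X_3^{\lambda}=\{x\in X:\lambda(x)=x\}$. For an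 involution $*$ on $K$ (regarded as a $K$-algebra), an involution $\lambda$ on $X$ and a map $\epsilon:X_3^{\lambda}\to K_0^\times$, where $K_0=\{a\in K:a^{*}=a\}$, let $\rho_\lambda^{*}(f)(x,y)=[f(\lambda(y),\lambda(x))]^{*}$, let $u_\epsilon\in FI(X,K)$ be the diagonal element with $u_\epsilon(x,x)=\epsilon(x)$ for $x\in X_3^{\lambda}$ and $u_\epsilon(x,x)=1$ otherwise, and let $\rho_\epsilon=\Psi_{u_\epsilon}\circ\rho_\lambda^{*}$, an involution on $FI(X,K)$. Two involutions $\rho,\rho'$ on $FI(X,K)$ are equivalent if $\Phi\circ\rho=\rho'\circ\Phi$ for some $K$-algebra automorphism $\Phi$, and equivalent via inner automorphisms if $\Phi$ can be taken inner. Let $\lambda_1,\lambda_2$ be involutions on $X$ such that $|X_3^{\lambda_1}|=|X_3^{\lambda_2}|>1$. For $i=1,2$ let $*_i$ be an involution of the second kind on $K$, with fixed field $K_{0,i}=\{a\in K:a^{*_i}=a\}$, and let $\epsilon_i:X_3^{\lambda_i}\to K_{0,i}^\times$ be a map, such that the involutions $\rho_{\epsilon_1}=\Psi_{u_{\epsilon_1}}\circ\rho_{\lambda_1}^{*_1}$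 and $\rho_{\epsilon_2}=\Psi_{u_{\epsilon_2}}\circ\rho_{\lambda_2}^{*_2}$ are not equivalent via inner automorphisms. Then $\rho_{\epsilon_1}$ and $\rho_{\epsilon_2}$ are equivalent if and only if $*_1=*_2$ and there exists an automorphism $\alpha$ of the poset $X$ such that $\alpha\circ\lambda_2=\lambda_1\circ\alpha$ and $\rho_{\epsilon_1}$ is equivalent, via inner automorphisms, to $\rho_{\epsilon_2\circ\alpha^{-1}}=\Psi_{u_{\epsilon_2\circ\alpha^{-1}}}\circ\rho_{\lambda_1}^{*_2}$, where $\epsilon_2\circ\alpha^{-1}:X_3^{\lambda_1}\to K_{0,2}^\times$. -/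

import Mathlib

namespace FinInc

universe u v

/-! ### Posets -/

/-- A poset is connected if any two points are joined by a finite path whose consecutive points are
comparable. -/
def PosetConnected (X : Type u) [PartialOrder X] : Prop :=
  ∀ x y : X, Relation.ReflTransGen (fun a b : X => a ≤ b ∨ b ≤ a) x y

/-- An involution on a poset: an order-reversing map of order two (or one). -/
structure PosetInvolution (X : Type u) [PartialOrder X] where
  toFun : X → X
  apply_apply' : ∀ x, toFun (toFun x) = x
  le_iff' : ∀ x y, x ≤ y ↔ toFun y ≤ toFun x

instance {X : Type u} [PartialOrder X] : CoeFun (PosetInvolution X) (fun _ => X → X) :=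
  ⟨PosetInvolution.toFun⟩

section Poset

variable {X : Type u} [PartialOrder X]

theorem PosetInvolution.apply_apply (l : PosetInvolution X) (x : X) : l (l x) = x :=
  l.apply_apply' x

theorem PosetInvolution.le_iff (l : PosetInvolution X) (x y : X) : x ≤ y ↔ l y ≤ l x :=
  l.le_iff' x y

/-- The set `X₃` of fixed points of an involution on the poset `X`. -/
def fixedSet (l : PosetInvolution X) : Set X := {x | l x = x}

/-- If `α ∘ l₂ = l₁ ∘ α`, then `α⁻¹` maps the fixed points of `l₁` to those of `l₂`. -/
def symmOnFixed {l₁ l₂ : PosetInvolution X} (α : X ≃o X) (h : ∀ x, α (l₂ x) = l₁ (α x)) :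
    fixedSet l₁ → fixedSet l₂ :=
  fun x => ⟨α.symm x.1, by
    have hx : l₁ x.1 = x.1 := x.2
    change l₂ (α.symm x.1) = α.symm x.1
    apply α.injective
    rw [h, α.apply_symm_apply, hx]⟩

end Poset

/-! ### Involutions on an algebra

An involution on a ring is Mathlib's `RingInvo`; the image of `a` under the involution `ρ`
is `(ρ a).unop`. -/

section Algebras

/-- An involution is of the second kind if it is not the identity on the center. -/
def IsSecondKind {A : Type u} [Ring A] (ρ : RingInvo A) : Prop :=
  ∃ a ∈ Subring.center A, (ρ a).unop ≠ a

variable (K : Type v) [Field K] {A : Type u} [Ring A] [Algebra K A]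

/-- The inner automorphism `a ↦ u a u⁻¹`. -/
def innerAut (u : Aˣ) : A ≃ₐ[K] A where
  toFun a := u * a * ((u⁻¹ : Aˣ) : A)
  invFun a := ((u⁻¹ : Aˣ) : A) * a * u
  left_inv a := by simp [mul_assoc]
  right_inv a := by simp [mul_assoc]
  map_mul' a b := by simp [mul_assoc]
  map_add' a b := by simp [mul_add, add_mul]
  commutes' k := by rw [← Algebra.commutes, mul_assoc, Units.mul_inv, mul_one]

variable {K}

/-- A `K`-algebra automorphism is inner. -/
def IsInner (Φ : A ≃ₐ[K] A) : Prop := ∃ u : Aˣ, Φ = innerAut K u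

variable (K)

/-- Two involutions are equivalent if `Φ ∘ ρ₁ = ρ₂ ∘ Φ` for some automorphism `Φ` of the
`K`-algebra `A`. -/
def Equivalent (ρ₁ ρ₂ : RingInvo A) : Prop :=
  ∃ Φ : A ≃ₐ[K] A, ∀ a, Φ (ρ₁ a).unop = (ρ₂ (Φ a)).unop

/-- Two involutions are equivalent via inner automorphisms if `Φ ∘ ρ₁ = ρ₂ ∘ Φ` for some inner
automorphism `Φ` of the `K`-algebra `A`. -/
def InnerEquivalent (ρ₁ ρ₂ : RingInvo A) : Prop :=
  ∃ Φ : A ≃ₐ[K] A, IsInner Φ ∧ ∀ a, Φ (ρ₁ a).unop = (ρ₂ (Φ a)).unop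

/-- The involution `Ψ_u ∘ ρ`, where `Ψ_u` is the inner automorphism defined by a `ρ`-symmetric
unit `u`. -/
def innerComp {A : Type u} [Ring A] (u : Aˣ) (ρ : RingInvo A)
    (hu : (ρ (u : A)).unop = u) : RingInvo A :=
  RingInvo.mk'
    { toFun := fun a => MulOpposite.op (u * (ρ a).unop * ((u⁻¹ : Aˣ) : A))
      map_one' := by simp
      map_mul' := fun a b => by
        apply MulOpposite.unop_injective
        simp [mul_assoc]
      map_zero' := by simp
      map_add' := fun a b => by
        apply MulOpposite.unop_injective
        simp [mul_add, add_mul] }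
    (fun a => by
      have hinv : (ρ ((u⁻¹ : Aˣ) : A)).unop = ((u⁻¹ : Aˣ) : A) := by
        have h1 : (ρ ((u⁻¹ : Aˣ) : A)).unop * (ρ (u : A)).unop = 1 := by
          rw [← MulOpposite.unop_mul, ← map_mul]
          simp
        rw [hu] at h1
        exact (Units.inv_eq_of_mul_eq_one_left h1).symm
      simp [hu, hinv, mul_assoc])

end Algebras

/-- The subfield `K₀` of elements fixed by an involution on the field `K`. -/
def fixedSubfield {K : Type v} [Field K] (s : RingInvo K) : Subfield K where
  carrier := {a | (s a).unop = a}
  mul_mem' {a b} ha hb := by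
    simp only [Set.mem_ofPred_eq] at *
    rw [map_mul, MulOpposite.unop_mul, ha, hb, mul_comm]
  one_mem' := by simp
  add_mem' {a b} ha hb := by
    simp only [Set.mem_ofPred_eq] at *
    rw [map_add, MulOpposite.unop_add, ha, hb]
  zero_mem' := by simp
  neg_mem' {a} ha := by
    simp only [Set.mem_ofPred_eq] at *
    rw [map_neg, MulOpposite.unop_neg, ha]
  inv_mem' a ha := by
    simp only [Set.mem_ofPred_eq] at *
    rw [map_inv₀, MulOpposite.unop_inv, ha]

/-! ### The finitary incidence algebra

The incidence space `I(X, K)` is Mathlib's type `IncidenceAlgebra K X`, used here only as a vector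
space since `X` need not be locally finite. -/

section Finitary

/-- `f` is finitary: for `x ≤ y` there are only finitely many subintervals `[u, v]` of `[x, y]` with
`u ≠ v` and `f u v ≠ 0`. -/
def IsFinitary {X : Type u} [PartialOrder X] {K : Type v} [Field K]
    (f : IncidenceAlgebra K X) : Prop :=
  ∀ x y : X, x ≤ y →
    {p : X × X | x ≤ p.1 ∧ p.1 < p.2 ∧ p.2 ≤ y ∧ f p.1 p.2 ≠ 0}.Finite

/-- The finitary elements, as a subspace of the incidence space. -/
def finitarySubmodule (X : Type u) [PartialOrder X] (K : Type v) [Field K] :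
    Submodule K (IncidenceAlgebra K X) where
  carrier := {f | IsFinitary f}
  zero_mem' := fun x y _ => by simp
  add_mem' := fun {f g} hf hg x y hxy => by
    refine ((hf x y hxy).union (hg x y hxy)).subset ?_
    rintro p ⟨h1, h2, h3, h4⟩
    by_cases hp : f p.1 p.2 = 0
    · exact Or.inr ⟨h1, h2, h3, fun hq => h4 (by simp [hp, hq])⟩
    · exact Or.inl ⟨h1, h2, h3, hp⟩
  smul_mem' := fun c f hf x y hxy => by
    refine (hf x y hxy).subset ?_
    rintro p ⟨h1, h2, h3, h4⟩
    exact ⟨h1, h2, h3, fun hq => h4 (by simp [IncidenceAlgebra.constSMul_apply, hq])⟩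

/-- The finitary incidence algebra `FI(X, K)`. -/
abbrev FI (X : Type u) [PartialOrder X] (K : Type v) [Field K] : Type (max u v) :=
  finitarySubmodule X K

variable {X : Type u} [PartialOrder X] {K : Type v} [Field K]

theorem FI.ext' {f g : FI X K} (h : ∀ x y, x ≤ y → f.1 x y = g.1 x y) : f = g :=
  Subtype.ext (IncidenceAlgebra.ext h)

theorem FI.eq_zero (f : FI X K) {x y : X} (h : ¬ x ≤ y) : f.1 x y = 0 :=
  IncidenceAlgebra.apply_eq_zero_of_not_le h _

theorem FI.finite_left (f : FI X K) (x y : X) : {z | z ≤ y ∧ f.1 x z ≠ 0}.Finite := by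
  by_cases hxy : x ≤ y
  · refine (((f.2 x y hxy).image Prod.snd).union (Set.finite_singleton x)).subset ?_
    rintro z ⟨h1, h2⟩
    have h3 : x ≤ z := IncidenceAlgebra.le_of_ne_zero h2
    rcases h3.eq_or_lt with h | h
    · exact Or.inr h.symm
    · exact Or.inl ⟨(x, z), ⟨le_rfl, h, h1, h2⟩, rfl⟩
  · refine Set.finite_empty.subset ?_
    rintro z ⟨h1, h2⟩
    exact hxy ((IncidenceAlgebra.le_of_ne_zero h2).trans h1)

theorem FI.finite_right (f : FI X K) (x y : X) : {z | x ≤ z ∧ f.1 z y ≠ 0}.Finite := by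
  by_cases hxy : x ≤ y
  · refine (((f.2 x y hxy).image Prod.fst).union (Set.finite_singleton y)).subset ?_
    rintro z ⟨h1, h2⟩
    have h3 : z ≤ y := IncidenceAlgebra.le_of_ne_zero h2
    rcases h3.eq_or_lt with h | h
    · exact Or.inr h
    · exact Or.inl ⟨(z, y), ⟨h1, h, le_rfl, h2⟩, rfl⟩
  · refine Set.finite_empty.subset ?_
    rintro z ⟨h1, h2⟩
    exact hxy (h1.trans (IncidenceAlgebra.le_of_ne_zero h2))

/-- The convolution product, `(f g)(x, y) = ∑_{x ≤ z ≤ y} f(x, z) g(z, y)`; the sum has only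
finitely many nonzero terms. -/
noncomputable instance : Mul (FI X K) where
  mul f g := ⟨⟨fun x y => ∑ᶠ z ∈ Set.Icc x y, f.1 x z * g.1 z y, fun x y h => by
      simp [Set.Icc_eq_empty h]⟩, by
    intro x y hxy
    refine (((f.2 x y hxy).union (g.2 x y hxy)).union
      (((f.2 x y hxy).prod (g.2 x y hxy)).image (fun q => (q.1.1, q.2.2)))).subset ?_
    rintro ⟨a, b⟩ ⟨h1, h2, h3, h4⟩
    obtain ⟨z, ⟨hz1, hz2⟩, hz⟩ := exists_ne_zero_of_finsum_mem_ne_zero h4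
    have hf := left_ne_zero_of_mul hz
    have hg := right_ne_zero_of_mul hz
    rcases hz1.eq_or_lt with h | h
    · subst h
      exact Or.inl (Or.inr ⟨h1, h2, h3, hg⟩)
    rcases hz2.eq_or_lt with h' | h'
    · subst h'
      exact Or.inl (Or.inl ⟨h1, h2, h3, hf⟩)
    · exact Or.inr ⟨((a, z), (z, b)), ⟨⟨h1, h, hz2.trans h3, hf⟩, ⟨h1.trans hz1, h', h3, hg⟩⟩, rfl⟩⟩

theorem FI.mul_apply (f g : FI X K) (x y : X) :
    (f * g).1 x y = ∑ᶠ z ∈ Set.Icc x y, f.1 x z * g.1 z y := rfl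

theorem FI.mul_apply_eq_sum (f g : FI X K) (x y : X) (s : Finset X)
    (hs : ∀ z, x ≤ z → z ≤ y → f.1 x z ≠ 0 → g.1 z y ≠ 0 → z ∈ s) :
    (f * g).1 x y = ∑ z ∈ s, f.1 x z * g.1 z y := by
  rw [FI.mul_apply]
  apply finsum_mem_eq_sum_of_inter_support_eq
  ext z
  simp only [Set.mem_inter_iff, Set.mem_Icc, Function.mem_support, Finset.mem_coe]
  constructor
  · rintro ⟨⟨h1, h2⟩, h3⟩
    exact ⟨hs z h1 h2 (left_ne_zero_of_mul h3) (right_ne_zero_of_mul h3), h3⟩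
  · rintro ⟨_, h3⟩
    exact ⟨⟨IncidenceAlgebra.le_of_ne_zero (left_ne_zero_of_mul h3),
      IncidenceAlgebra.le_of_ne_zero (right_ne_zero_of_mul h3)⟩, h3⟩

theorem FI.mul_apply_left (f g : FI X K) (x y w : X) (h : y ≤ w) :
    (f * g).1 x y = ∑ z ∈ (f.finite_left x w).toFinset, f.1 x z * g.1 z y := by
  apply FI.mul_apply_eq_sum
  intro z _ h2 h3 _
  simpa using ⟨h2.trans h, h3⟩

theorem FI.mul_apply_right (f g : FI X K) (x y w : X) (h : w ≤ x) :
    (f * g).1 x y = ∑ z ∈ (g.finite_right w y).toFinset, f.1 x z * g.1 z y := by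
  apply FI.mul_apply_eq_sum
  intro z h1 _ _ h3
  simpa using ⟨h.trans h1, h3⟩

open Classical in
/-- The diagonal element of `FI(X, K)` with diagonal entries `d`. -/
noncomputable def diag (d : X → K) : FI X K :=
  ⟨⟨fun x y => if x = y then d x else 0, fun x y h => if_neg (fun e => h e.le)⟩, by
    intro x y _
    refine Set.finite_empty.subset ?_
    rintro p ⟨_, h2, _, h4⟩
    exact h4 (if_neg h2.ne)⟩

open Classical in
theorem diag_apply (d : X → K) (x y : X) :
    (diag d).1 x y = if x = y then d x else 0 := rfl

theorem diag_mul_apply (d : X → K) (f : FI X K) (x y : X) :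
    (diag d * f).1 x y = d x * f.1 x y := by
  rw [FI.mul_apply_eq_sum _ _ x y {x}]
  · simp [diag_apply]
  · intro z _ _ h _
    by_contra hz
    exact h (by rw [diag_apply, if_neg]; simpa [eq_comm] using hz)

theorem mul_diag_apply (d : X → K) (f : FI X K) (x y : X) :
    (f * diag d).1 x y = f.1 x y * d y := by
  rw [FI.mul_apply_eq_sum _ _ x y {y}]
  · simp [diag_apply]
  · intro z _ _ _ h
    by_contra hz
    exact h (by rw [diag_apply, if_neg]; simpa using hz)

/-- The unity `δ` of `FI(X, K)`. -/
noncomputable instance : One (FI X K) := ⟨diag fun _ => 1⟩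

theorem FI.one_def : (1 : FI X K) = diag fun _ => 1 := rfl

theorem FI.add_apply (f g : FI X K) (x y : X) : (f + g).1 x y = f.1 x y + g.1 x y := rfl

theorem FI.smul_apply (k : K) (f : FI X K) (x y : X) : (k • f).1 x y = k * f.1 x y := rfl

theorem FI.zero_apply (x y : X) : (0 : FI X K).1 x y = 0 := rfl

theorem FI.mul_assoc' (f g h : FI X K) : f * g * h = f * (g * h) := by
  apply FI.ext'
  intro x y _
  rw [FI.mul_apply_right (f * g) h x y x le_rfl, FI.mul_apply_left f (g * h) x y y le_rfl]
  have e1 : ∀ w ∈ (h.finite_right x y).toFinset, (f * g).1 x w * h.1 w y =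
      ∑ z ∈ (f.finite_left x y).toFinset, f.1 x z * g.1 z w * h.1 w y := by
    intro w hw
    have hw' : h.1 w y ≠ 0 := by
      have := (Set.Finite.mem_toFinset _).1 hw
      exact this.2
    rw [FI.mul_apply_left f g x w y (IncidenceAlgebra.le_of_ne_zero hw'), Finset.sum_mul]
  have e2 : ∀ z ∈ (f.finite_left x y).toFinset, f.1 x z * (g * h).1 z y =
      ∑ w ∈ (h.finite_right x y).toFinset, f.1 x z * g.1 z w * h.1 w y := by
    intro z hz
    have hz' : f.1 x z ≠ 0 := by
      have := (Set.Finite.mem_toFinset _).1 hz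
      exact this.2
    rw [FI.mul_apply_right g h z y x (IncidenceAlgebra.le_of_ne_zero hz'), Finset.mul_sum]
    exact Finset.sum_congr rfl fun w _ => (mul_assoc _ _ _).symm
  rw [Finset.sum_congr rfl e1, Finset.sum_congr rfl e2, Finset.sum_comm]

noncomputable instance : Ring (FI X K) :=
  { (inferInstance : AddCommGroup (FI X K)) with
    mul := (· * ·)
    one := 1
    mul_assoc := FI.mul_assoc'
    one_mul := fun f => FI.ext' fun x y _ => by rw [FI.one_def, diag_mul_apply, one_mul]
    mul_one := fun f => FI.ext' fun x y _ => by rw [FI.one_def, mul_diag_apply, mul_one]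
    zero_mul := fun f => FI.ext' fun x y _ => by
      rw [FI.mul_apply_left _ _ x y y le_rfl]
      simp
    mul_zero := fun f => FI.ext' fun x y _ => by
      rw [FI.mul_apply_left _ _ x y y le_rfl]
      simp
    left_distrib := fun f g h => FI.ext' fun x y _ => by
      rw [FI.add_apply, FI.mul_apply_left _ _ x y y le_rfl, FI.mul_apply_left _ _ x y y le_rfl,
        FI.mul_apply_left _ _ x y y le_rfl, ← Finset.sum_add_distrib]
      exact Finset.sum_congr rfl fun z _ => mul_add _ _ _
    right_distrib := fun f g h => FI.ext' fun x y _ => by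
      rw [FI.add_apply, FI.mul_apply_right _ _ x y x le_rfl, FI.mul_apply_right _ _ x y x le_rfl,
        FI.mul_apply_right _ _ x y x le_rfl, ← Finset.sum_add_distrib]
      exact Finset.sum_congr rfl fun z _ => add_mul _ _ _ }

noncomputable instance : Algebra K (FI X K) :=
  Algebra.ofModule
    (fun k f g => FI.ext' fun x y _ => by
      rw [FI.smul_apply, FI.mul_apply_left f g x y y le_rfl, Finset.mul_sum,
        FI.mul_apply_eq_sum (k • f) g x y (f.finite_left x y).toFinset]
      · exact Finset.sum_congr rfl fun z _ => by rw [FI.smul_apply, mul_assoc]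
      · intro z _ h2 h3 _
        rw [FI.smul_apply] at h3
        simpa using ⟨h2, right_ne_zero_of_mul h3⟩)
    (fun k f g => FI.ext' fun x y _ => by
      rw [FI.smul_apply, FI.mul_apply_left f g x y y le_rfl, Finset.mul_sum,
        FI.mul_apply_left f (k • g) x y y le_rfl]
      exact Finset.sum_congr rfl fun z _ => by rw [FI.smul_apply, mul_left_comm])

/-! ### Multiplicative automorphisms -/

/-- `σ` is multiplicative: `σ(x, y) ≠ 0` for `x ≤ y` and `σ(x, y) σ(y, z) = σ(x, z)` for
`x ≤ y ≤ z`. -/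
structure IsMultiplicative (σ : IncidenceAlgebra K X) : Prop where
  ne_zero : ∀ x y, x ≤ y → σ x y ≠ 0
  mul_eq : ∀ x y z, x ≤ y → y ≤ z → σ x y * σ y z = σ x z

theorem IsMultiplicative.apply_self {σ : IncidenceAlgebra K X} (hσ : IsMultiplicative σ) (x : X) :
    σ x x = 1 :=
  mul_left_cancel₀ (hσ.ne_zero x x le_rfl)
    ((hσ.mul_eq x x x le_rfl le_rfl).trans (mul_one _).symm)

/-- The entrywise product of a finitary element by an arbitrary function. -/
def entrywise (σ : X → X → K) (f : FI X K) : FI X K :=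
  ⟨⟨fun x y => σ x y * f.1 x y, fun x y h => by rw [FI.eq_zero f h, mul_zero]⟩, by
    intro x y hxy
    refine (f.2 x y hxy).subset ?_
    rintro p ⟨h1, h2, h3, h4⟩
    exact ⟨h1, h2, h3, right_ne_zero_of_mul h4⟩⟩

theorem entrywise_apply (σ : X → X → K) (f : FI X K) (x y : X) :
    (entrywise σ f).1 x y = σ x y * f.1 x y := rfl

/-- The multiplicative automorphism `M_σ`, `M_σ(f)(x, y) = σ(x, y) f(x, y)`. -/
noncomputable def multAut (σ : IncidenceAlgebra K X) (hσ : IsMultiplicative σ) :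
    FI X K ≃ₐ[K] FI X K where
  toFun f := entrywise (fun x y => σ x y) f
  invFun f := entrywise (fun x y => (σ x y)⁻¹) f
  left_inv f := FI.ext' fun x y h => by
    rw [entrywise_apply, entrywise_apply, inv_mul_cancel_left₀ (hσ.ne_zero x y h)]
  right_inv f := FI.ext' fun x y h => by
    rw [entrywise_apply, entrywise_apply, mul_inv_cancel_left₀ (hσ.ne_zero x y h)]
  map_mul' f g := FI.ext' fun x y _ => by
    rw [entrywise_apply, FI.mul_apply_left f g x y y le_rfl, Finset.mul_sum,
      FI.mul_apply_eq_sum (entrywise (fun x y => σ x y) f) _ x y (f.finite_left x y).toFinset]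
    · refine Finset.sum_congr rfl fun z hz => ?_
      have hz' := (Set.Finite.mem_toFinset _).1 hz
      rw [entrywise_apply, entrywise_apply,
        ← hσ.mul_eq x z y (IncidenceAlgebra.le_of_ne_zero hz'.2) hz'.1]
      ring
    · intro z _ h2 h3 _
      rw [entrywise_apply] at h3
      simpa using ⟨h2, right_ne_zero_of_mul h3⟩
  map_add' f g := FI.ext' fun x y _ => by
    rw [FI.add_apply, entrywise_apply, entrywise_apply, entrywise_apply, FI.add_apply, mul_add]
  commutes' k := FI.ext' fun x y _ => by
    rw [entrywise_apply, Algebra.algebraMap_eq_smul_one, FI.smul_apply, FI.one_def, diag_apply]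
    split_ifs with h
    · subst h
      rw [hσ.apply_self, one_mul]
    · simp

variable (X K) in
/-- Every multiplicative automorphism of `FI(X, K)` is inner. -/
def MultiplicativeAutsInner : Prop :=
  ∀ (σ : IncidenceAlgebra K X) (hσ : IsMultiplicative σ), IsInner (multAut σ hσ)

/-! ### The involutions `ρ_l^*` and `ρ_ε` -/

/-- The map `ρ_l^*(f)(x, y) = f(l(y), l(x))^*`. -/
def stdMap (s : RingInvo K) (l : PosetInvolution X) (f : FI X K) : FI X K :=
  ⟨⟨fun x y => (s (f.1 (l y) (l x))).unop, fun x y h => by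
      rw [FI.eq_zero f (fun h' => h ((l.le_iff x y).2 h')), map_zero, MulOpposite.unop_zero]⟩, by
    intro x y hxy
    refine ((f.2 (l y) (l x) ((l.le_iff x y).1 hxy)).image (fun p => (l p.2, l p.1))).subset ?_
    rintro ⟨a, b⟩ ⟨h1, h2, h3, h4⟩
    refine ⟨(l b, l a), ⟨(l.le_iff b y).1 h3, ?_, (l.le_iff x a).1 h1, ?_⟩, ?_⟩
    · refine lt_of_le_of_ne ((l.le_iff a b).1 h2.le) fun e => h2.ne ?_
      have := congrArg l e
      rwa [l.apply_apply, l.apply_apply, eq_comm] at this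
    · intro e
      exact h4 (by
        change (s (f.1 (l b) (l a))).unop = 0
        rw [show f.1 (l b) (l a) = 0 from e, map_zero, MulOpposite.unop_zero])
    · simp [l.apply_apply]⟩

theorem stdMap_apply (s : RingInvo K) (l : PosetInvolution X) (f : FI X K) (x y : X) :
    (stdMap s l f).1 x y = (s (f.1 (l y) (l x))).unop := rfl

open Classical in
theorem stdMap_diag (s : RingInvo K) (l : PosetInvolution X) (d : X → K) :
    stdMap s l (diag d) = diag (fun x => (s (d (l x))).unop) := by
  apply FI.ext'
  intro x y _
  rw [stdMap_apply, diag_apply, diag_apply]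
  by_cases h : x = y
  · subst h
    simp
  · have h' : l y ≠ l x := fun e => h (by
      have := congrArg l e
      rwa [l.apply_apply, l.apply_apply, eq_comm] at this)
    rw [if_neg h, if_neg h', map_zero, MulOpposite.unop_zero]

theorem stdMap_stdMap (s : RingInvo K) (l : PosetInvolution X) (f : FI X K) :
    stdMap s l (stdMap s l f) = f := by
  apply FI.ext'
  intro x y _
  rw [stdMap_apply, stdMap_apply, l.apply_apply, l.apply_apply, RingInvo.involution]

theorem stdMap_mul (s : RingInvo K) (l : PosetInvolution X) (f g : FI X K) :
    stdMap s l (f * g) = stdMap s l g * stdMap s l f := by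
  classical
  apply FI.ext'
  intro x y _
  rw [stdMap_apply, FI.mul_apply_left f g (l y) (l x) (l x) le_rfl,
    FI.mul_apply_eq_sum (stdMap s l g) (stdMap s l f) x y
      ((f.finite_left (l y) (l x)).toFinset.image l)]
  · rw [Finset.sum_image (fun a _ b _ e => by
      have := congrArg l e
      rwa [l.apply_apply, l.apply_apply] at this), map_sum, Finset.unop_sum]
    refine Finset.sum_congr rfl fun z _ => ?_
    rw [stdMap_apply, stdMap_apply, l.apply_apply, map_mul, MulOpposite.unop_mul]
  · intro z h1 _ _ h4
    rw [Finset.mem_image]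
    refine ⟨l z, ?_, l.apply_apply z⟩
    rw [Set.Finite.mem_toFinset]
    refine ⟨(l.le_iff x z).1 h1, fun e => h4 ?_⟩
    rw [stdMap_apply, e, map_zero, MulOpposite.unop_zero]

/-- The involution `ρ_l^*` on `FI(X, K)`, given by `ρ_l^*(f)(x, y) = f(l(y), l(x))^*`. -/
noncomputable def rhoStd (s : RingInvo K) (l : PosetInvolution X) : RingInvo (FI X K) :=
  RingInvo.mk'
    { toFun := fun f => MulOpposite.op (stdMap s l f)
      map_one' := by
        apply MulOpposite.unop_injective
        change stdMap s l 1 = 1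
        rw [FI.one_def, stdMap_diag]
        simp
      map_mul' := fun f g => by
        apply MulOpposite.unop_injective
        exact stdMap_mul s l f g
      map_zero' := by
        apply MulOpposite.unop_injective
        apply FI.ext'
        intro x y _
        change (stdMap s l 0).1 x y = (0 : FI X K).1 x y
        rw [stdMap_apply, FI.zero_apply, FI.zero_apply, map_zero, MulOpposite.unop_zero]
      map_add' := fun f g => by
        apply MulOpposite.unop_injective
        apply FI.ext'
        intro x y _
        change (stdMap s l (f + g)).1 x y = (stdMap s l f + stdMap s l g).1 x y
        rw [stdMap_apply, FI.add_apply, FI.add_apply, map_add, MulOpposite.unop_add, stdMap_apply,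
          stdMap_apply] }
    (stdMap_stdMap s l)

open Classical in
/-- The diagonal of `u_ε`: it is `ε(x)` at fixed points `x` of `l` and `1` elsewhere. -/
noncomputable def epsDiag {s : RingInvo K} {l : PosetInvolution X}
    (ε : fixedSet l → (fixedSubfield s)ˣ) (x : X) : K :=
  if h : x ∈ fixedSet l then ((ε ⟨x, h⟩ : fixedSubfield s) : K) else 1

theorem epsDiag_ne_zero {s : RingInvo K} {l : PosetInvolution X}
    (ε : fixedSet l → (fixedSubfield s)ˣ) (x : X) : epsDiag ε x ≠ 0 := by
  unfold epsDiag
  split_ifs with h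
  · simp
  · exact one_ne_zero

theorem diag_mul_diag (d e : X → K) : diag d * diag e = diag (fun x => d x * e x) := by
  classical
  apply FI.ext'
  intro x y _
  rw [diag_mul_apply, diag_apply, diag_apply, mul_ite, mul_zero]

/-- The diagonal unit `u_ε` of `FI(X, K)`. -/
noncomputable def uEps {s : RingInvo K} {l : PosetInvolution X}
    (ε : fixedSet l → (fixedSubfield s)ˣ) : (FI X K)ˣ where
  val := diag (epsDiag ε)
  inv := diag (fun x => (epsDiag ε x)⁻¹)
  val_inv := by
    rw [diag_mul_diag, FI.one_def]
    exact congrArg diag (funext fun x => mul_inv_cancel₀ (epsDiag_ne_zero ε x))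
  inv_val := by
    rw [diag_mul_diag, FI.one_def]
    exact congrArg diag (funext fun x => inv_mul_cancel₀ (epsDiag_ne_zero ε x))

theorem rhoStd_uEps (s : RingInvo K) (l : PosetInvolution X)
    (ε : fixedSet l → (fixedSubfield s)ˣ) :
    (rhoStd s l (uEps ε : FI X K)).unop = uEps ε := by
  change stdMap s l (diag (epsDiag ε)) = diag (epsDiag ε)
  rw [stdMap_diag]
  refine congrArg diag (funext fun x => ?_)
  by_cases h : x ∈ fixedSet l
  · have hx : l x = x := h
    rw [hx, epsDiag, dif_pos h]
    exact (ε ⟨x, h⟩ : fixedSubfield s).2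
  · have h' : l x ∉ fixedSet l := fun e => h (by
      have e' : l (l x) = l x := e
      rw [l.apply_apply] at e'
      exact e'.symm)
    rw [epsDiag, epsDiag, dif_neg h, dif_neg h', map_one, MulOpposite.unop_one]

/-- The involution `ρ_ε = Ψ_{u_ε} ∘ ρ_l^*` on `FI(X, K)`. -/
noncomputable def rhoEps (s : RingInvo K) (l : PosetInvolution X)
    (ε : fixedSet l → (fixedSubfield s)ˣ) : RingInvo (FI X K) :=
  innerComp (uEps ε) (rhoStd s l) (rhoStd_uEps s l ε)

end Finitary

end FinInc

open FinInc

namespace FinInc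

universe u v

variable {X : Type u} [PartialOrder X] {K : Type v} [Field K]

/-! ### Diagonal idempotents and matrix units -/

/-! The main point is that every automorphism `Φ` of the algebra is inner up to a relabelling of
points by a poset automorphism. The involutions `ρ_ε` are then easy to transport, because
relabelling along an `α` that intertwines `l₂` with `l₁` carries `ρ_ε₂` exactly to `ρ_{ε₂ ∘ α⁻¹}`
(`relabel_rhoEps`).

Write `e_x` for the diagonal idempotent at `x`. Its corner is `K e_x`, so `Φ(e_x)` is an idempotent
with a one-dimensional corner; its diagonal therefore has a single 1, at a point depending on `x`.
This assignment is a poset automorphism (`inducedIso`). After undoing it, `Φ(e_x)` has diagonal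
entry 1 at `x`. The columns of the `Φ(e_x)` at `x` assemble to a unit conjugating all `e_x` to
`Φ(e_x)` at once. That this matrix is finitary is the delicate step (`finite_columns`): otherwise
some 0-1 diagonal element would have a non-finitary image. What is left fixes every `e_x`, hence is
multiplicative, hence inner by hypothesis.

If `Φ` intertwines the two involutions, then comparing scalars gives `s₁ = s₂`. Inner automorphisms
preserve diagonals, so comparing diagonals shows that `α` intertwines the poset involutions, and the
inner automorphism obtained from `Φ` and `α` gives the required inner equivalence. Conversely, an
inner equivalence composed with the inverse relabelling is an equivalence. -/

theorem FI.mul_apply_self (f g : FI X K) (x : X) : (f * g).1 x x = f.1 x x * g.1 x x := by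
  rw [FI.mul_apply_eq_sum f g x x {x}, Finset.sum_singleton]
  intro z h1 h2 _ _
  exact Finset.mem_singleton.2 (le_antisymm h2 h1)

theorem FI.sub_apply (f g : FI X K) (x y : X) : (f - g).1 x y = f.1 x y - g.1 x y := rfl

open Classical in
theorem FI.one_apply (x y : X) : (1 : FI X K).1 x y = if x = y then 1 else 0 := rfl

open Classical in
/-- The matrix unit at the pair `x ≤ y`; it is zero if `x ≰ y`. -/
noncomputable def matUnit (K : Type v) [Field K] (x y : X) : FI X K :=
  ⟨⟨fun a b => if a ≤ b ∧ a = x ∧ b = y then 1 else 0, fun a b h => if_neg fun h' => h h'.1⟩, by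
    intro a b _
    refine (Set.finite_singleton (x, y)).subset ?_
    rintro ⟨c, d⟩ ⟨_, _, _, h⟩
    have h' : c ≤ d ∧ c = x ∧ d = y := by
      by_contra hn
      exact h (if_neg hn)
    exact Prod.ext h'.2.1 h'.2.2⟩

open Classical in
theorem matUnit_apply (x y a b : X) :
    (matUnit K x y).1 a b = if a ≤ b ∧ a = x ∧ b = y then 1 else 0 := rfl

open Classical in
/-- The diagonal idempotent at the point `x`. -/
noncomputable def pointIdem (K : Type v) [Field K] (x : X) : FI X K :=
  diag fun z => if z = x then 1 else 0

open Classical in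
theorem pointIdem_mul_apply (x : X) (f : FI X K) (a b : X) :
    (pointIdem K x * f).1 a b = if a = x then f.1 a b else 0 := by
  rw [pointIdem, diag_mul_apply, ite_mul, one_mul, zero_mul]

open Classical in
theorem mul_pointIdem_apply (x : X) (f : FI X K) (a b : X) :
    (f * pointIdem K x).1 a b = if b = x then f.1 a b else 0 := by
  rw [pointIdem, mul_diag_apply, mul_ite, mul_one, mul_zero]

open Classical in
theorem pointIdem_apply (x a b : X) :
    (pointIdem K x).1 a b = if a = b ∧ a = x then 1 else 0 := by
  rw [pointIdem, diag_apply, ite_and]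

theorem pointIdem_apply_self (x : X) : (pointIdem K x).1 x x = 1 := by
  simp [pointIdem_apply]

theorem pointIdem_ne_zero (x : X) : pointIdem K x ≠ 0 := fun h =>
  one_ne_zero ((pointIdem_apply_self (K := K) x).symm.trans (by rw [h]; rfl))

open Classical in
theorem pointIdem_mul_pointIdem (x y : X) :
    pointIdem K x * pointIdem K y = if x = y then pointIdem K x else 0 := by
  apply FI.ext'
  intro a b _
  rw [pointIdem_mul_apply, pointIdem_apply]
  by_cases hxy : x = y
  · subst hxy
    rw [if_pos rfl, pointIdem_apply]
    by_cases hax : a = x <;> simp [hax]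
  · rw [if_neg hxy, FI.zero_apply]
    by_cases hax : a = x
    · subst hax
      simp [hxy]
    · simp [hax]

theorem pointIdem_mul_self (x : X) : pointIdem K x * pointIdem K x = pointIdem K x := by
  rw [pointIdem_mul_pointIdem, if_pos rfl]

/-- Corners of the algebra are at most one-dimensional, and zero at pairs `x ≰ y`. Single entries
are thus visible to algebra automorphisms, which replaces any expansion of `f` as an infinite sum.
-/
theorem corner_eq (f : FI X K) (x y : X) :
    pointIdem K x * f * pointIdem K y = f.1 x y • matUnit K x y := by
  apply FI.ext'
  intro a b hab
  rw [mul_pointIdem_apply, pointIdem_mul_apply, FI.smul_apply, matUnit_apply]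
  by_cases hb : b = y
  · by_cases ha : a = x
    · subst ha hb
      simp [hab]
    · simp [ha]
  · simp [hb]

open Classical in
theorem matUnit_self (x : X) : matUnit K x x = pointIdem K x := by
  apply FI.ext'
  intro a b hab
  rw [matUnit_apply, pointIdem_apply]
  refine if_congr ⟨fun h => ⟨h.2.1.trans h.2.2.symm, h.2.1⟩, fun h => ⟨hab, h.2, ?_⟩⟩ rfl rfl
  exact h.1.symm.trans h.2

theorem matUnit_apply_of_le {x y : X} (h : x ≤ y) : (matUnit K x y).1 x y = 1 := by
  simp [matUnit_apply, h]

theorem pointIdem_mul_matUnit_mul {x y : X} (h : x ≤ y) :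
    pointIdem K x * matUnit K x y * pointIdem K y = matUnit K x y := by
  rw [corner_eq, matUnit_apply_of_le h, one_smul]

theorem matUnit_mul_matUnit {x y z : X} (hxy : x ≤ y) (hyz : y ≤ z) :
    matUnit K x y * matUnit K y z = matUnit K x z := by
  have h : (matUnit K x y * matUnit K y z).1 x z = 1 := by
    rw [FI.mul_apply_eq_sum _ _ x z {y}, Finset.sum_singleton, matUnit_apply_of_le hxy,
      matUnit_apply_of_le hyz, one_mul]
    intro w _ _ hw _
    by_contra hn
    exact hw (by rw [matUnit_apply, if_neg fun h' => hn (Finset.mem_singleton.2 h'.2.2)])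
  calc matUnit K x y * matUnit K y z
      = (pointIdem K x * matUnit K x y * pointIdem K y) *
          (pointIdem K y * matUnit K y z * pointIdem K z) := by
        rw [pointIdem_mul_matUnit_mul hxy, pointIdem_mul_matUnit_mul hyz]
    _ = pointIdem K x * ((matUnit K x y * pointIdem K y) *
          (pointIdem K y * matUnit K y z)) * pointIdem K z := by simp only [mul_assoc]
    _ = matUnit K x z := by
        rw [corner_eq, show (matUnit K x y * pointIdem K y * (pointIdem K y * matUnit K y z)) =
          matUnit K x y * matUnit K y z from ?_, h, one_smul]
        have e1 : matUnit K x y * pointIdem K y = matUnit K x y := by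
          conv_lhs => rw [← pointIdem_mul_matUnit_mul hxy, mul_assoc _ (pointIdem K y),
            pointIdem_mul_self]
          exact pointIdem_mul_matUnit_mul hxy
        have e2 : pointIdem K y * matUnit K y z = matUnit K y z := by
          conv_lhs => rw [← pointIdem_mul_matUnit_mul hyz, ← mul_assoc, ← mul_assoc,
            pointIdem_mul_self]
          exact pointIdem_mul_matUnit_mul hyz
        rw [e1, e2]

/-- An idempotent with zero diagonal vanishes. -/
theorem eq_zero_of_idempotent {w : FI X K} (hw : w * w = w) (h0 : ∀ x, w.1 x x = 0) : w = 0 := by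
  apply FI.ext'
  intro x y _
  rw [FI.zero_apply]
  by_contra hne
  -- With `z` minimal among the nonzero entries of row `x` below `y`, a nonzero term of `(w * w)(x,
  -- z)` can only come from `t = z`, where the factor `w(z, z)` vanishes.
  obtain ⟨z, hz⟩ := (w.finite_left x y).exists_minimal ⟨y, le_rfl, hne⟩
  refine hz.prop.2 ?_
  rw [← hw, FI.mul_apply]
  refine finsum_mem_eq_zero_of_forall_eq_zero fun t ht => ?_
  by_cases h1 : w.1 x t = 0
  · rw [h1, zero_mul]
  · have : t = z := le_antisymm ht.2 (hz.le_of_le ⟨ht.2.trans hz.prop.1, h1⟩ ht.2)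
    rw [this, h0, mul_zero]

/-! ### The permutation of points induced by an automorphism -/

section Perm

variable (Φ : FI X K ≃ₐ[K] FI X K)

theorem map_pointIdem_mul_self (x : X) :
    Φ (pointIdem K x) * Φ (pointIdem K x) = Φ (pointIdem K x) := by
  rw [← map_mul, pointIdem_mul_self]

/-- The corner of `pointIdem K x` consists of its scalar multiples, a property that `Φ` transports.
-/
theorem map_pointIdem_corner (x : X) (f : FI X K) :
    ∃ c : K, Φ (pointIdem K x) * f * Φ (pointIdem K x) = c • Φ (pointIdem K x) := by
  refine ⟨(Φ.symm f).1 x x, ?_⟩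
  conv_lhs => rw [← Φ.apply_symm_apply f]
  rw [← map_mul, ← map_mul, corner_eq, matUnit_self, map_smul]

-- A nonzero idempotent has a nonzero diagonal entry, say at `y`. Sandwiching `pointIdem K y` gives
-- `c • Φ (pointIdem K x)`: the entry at `y` forces `c = 1`, and then every other diagonal entry is
-- 0, since the sandwich vanishes there.
open Classical in
theorem exists_map_pointIdem_diag (x : X) :
    ∃ y, ∀ z, (Φ (pointIdem K x)).1 z z = if z = y then 1 else 0 := by
  obtain ⟨y, hy⟩ : ∃ y, (Φ (pointIdem K x)).1 y y ≠ 0 := by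
    by_contra! h
    exact pointIdem_ne_zero x ((map_eq_zero_iff Φ Φ.injective).1
      (eq_zero_of_idempotent (map_pointIdem_mul_self Φ x) h))
  obtain ⟨c, hc⟩ := map_pointIdem_corner Φ x (pointIdem K y)
  have hd : ∀ z, (Φ (pointIdem K x)).1 z z * (pointIdem K y).1 z z * (Φ (pointIdem K x)).1 z z =
      c * (Φ (pointIdem K x)).1 z z := fun z => by
    rw [← FI.mul_apply_self, ← FI.mul_apply_self, hc, FI.smul_apply]
  have hi : ∀ z, (Φ (pointIdem K x)).1 z z * (Φ (pointIdem K x)).1 z z =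
      (Φ (pointIdem K x)).1 z z := fun z => by
    rw [← FI.mul_apply_self, map_pointIdem_mul_self]
  have h1 : (Φ (pointIdem K x)).1 y y = 1 := mul_left_cancel₀ hy ((hi y).trans (mul_one _).symm)
  have hc1 : c = 1 := by
    have := hd y
    rw [h1, pointIdem_apply_self] at this
    simpa using this.symm
  refine ⟨y, fun z => ?_⟩
  split_ifs with hz
  · rw [hz, h1]
  · have := hd z
    rw [pointIdem_apply, if_neg fun h => hz h.2, hc1] at this
    simpa using this.symm

/-- The point whose diagonal idempotent is congruent to `Φ (pointIdem K x)` modulo elements of zero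
diagonal. -/
noncomputable def inducedMap (x : X) : X := (exists_map_pointIdem_diag Φ x).choose

open Classical in
theorem map_pointIdem_apply_self (x z : X) :
    (Φ (pointIdem K x)).1 z z = if z = inducedMap Φ x then 1 else 0 :=
  (exists_map_pointIdem_diag Φ x).choose_spec z

/-- This lets a diagonal idempotent be inserted next to `Φ (pointIdem K x)`, so that products of
images can be tested on actual corners. -/
theorem map_pointIdem_sandwich (x : X) :
    Φ (pointIdem K x) * pointIdem K (inducedMap Φ x) * Φ (pointIdem K x) = Φ (pointIdem K x) := by
  obtain ⟨c, hc⟩ := map_pointIdem_corner Φ x (pointIdem K (inducedMap Φ x))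
  have h := congrArg (fun f : FI X K => f.1 (inducedMap Φ x) (inducedMap Φ x)) hc
  simp only [FI.mul_apply_self, FI.smul_apply, map_pointIdem_apply_self, if_true,
    pointIdem_apply_self, mul_one] at h
  rw [hc, ← h, one_smul]

/-- With `y = inducedMap Φ x`, the `y`-corner of `Φ (pointIdem K x)` gives back `pointIdem K y`.
Applying `Φ.symm` and comparing diagonals identifies the point attached to `y` with `x`. -/
theorem inducedMap_symm_apply (x : X) : inducedMap Φ.symm (inducedMap Φ x) = x := by
  have h1 : pointIdem K (inducedMap Φ x) * Φ (pointIdem K x) * pointIdem K (inducedMap Φ x) =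
      pointIdem K (inducedMap Φ x) := by
    rw [corner_eq, map_pointIdem_apply_self, if_pos rfl, one_smul, matUnit_self]
  have h2 := congrArg Φ.symm h1
  rw [map_mul, map_mul, Φ.symm_apply_apply] at h2
  have h3 := congrArg (fun f : FI X K =>
    f.1 (inducedMap Φ.symm (inducedMap Φ x)) (inducedMap Φ.symm (inducedMap Φ x))) h2
  simp only [FI.mul_apply_self, map_pointIdem_apply_self, if_true, one_mul, mul_one] at h3
  by_contra hn
  rw [pointIdem_apply, if_neg fun h => hn h.2] at h3
  exact zero_ne_one h3

/-- Otherwise the image of the matrix unit at `(x, y)` would factor through a corner at an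
incomparable or reversed pair, which is zero. -/
theorem inducedMap_mono {x y : X} (hxy : x ≤ y) : inducedMap Φ x ≤ inducedMap Φ y := by
  by_contra hn
  have h0 : matUnit K x y ≠ 0 := fun h =>
    one_ne_zero ((matUnit_apply_of_le (K := K) hxy).symm.trans (by rw [h]; rfl))
  refine h0 ((map_eq_zero_iff Φ Φ.injective).1 ?_)
  rw [← pointIdem_mul_matUnit_mul hxy, map_mul, map_mul, ← map_pointIdem_sandwich Φ x,
    ← map_pointIdem_sandwich Φ y]
  calc _ = Φ (pointIdem K x) * (pointIdem K (inducedMap Φ x) * (Φ (pointIdem K x) *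
        Φ (matUnit K x y) * Φ (pointIdem K y)) * pointIdem K (inducedMap Φ y)) *
          Φ (pointIdem K y) := by simp only [mul_assoc]
    _ = 0 := by rw [corner_eq, FI.eq_zero _ hn, zero_smul, mul_zero, zero_mul]

/-- The automorphism of the poset induced by an automorphism of its finitary incidence algebra. -/
noncomputable def inducedIso : X ≃o X where
  toFun := inducedMap Φ
  invFun := inducedMap Φ.symm
  left_inv := inducedMap_symm_apply Φ
  right_inv := inducedMap_symm_apply Φ.symm
  map_rel_iff' {x y} := by
    refine ⟨fun h => ?_, inducedMap_mono Φ⟩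
    have := inducedMap_mono Φ.symm h
    change inducedMap Φ.symm (inducedMap Φ x) ≤ inducedMap Φ.symm (inducedMap Φ y) at this
    rwa [inducedMap_symm_apply, inducedMap_symm_apply] at this

end Perm

/-! ### Automorphisms induced by automorphisms of the poset -/

/-- The finitary element obtained by relabelling along an automorphism of the poset. -/
def relabelFun (α : X ≃o X) (f : FI X K) : FI X K :=
  ⟨⟨fun x y => f.1 (α.symm x) (α.symm y), fun _ _ h =>
      FI.eq_zero f fun h' => h (α.symm.le_iff_le.1 h')⟩, by
    intro x y hxy
    refine ((f.2 (α.symm x) (α.symm y) (α.symm.monotone hxy)).image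
      (fun p => (α p.1, α p.2))).subset ?_
    rintro ⟨a, b⟩ ⟨h1, h2, h3, h4⟩
    exact ⟨(α.symm a, α.symm b), ⟨α.symm.monotone h1, α.symm.strictMono h2,
      α.symm.monotone h3, h4⟩, by simp⟩⟩

theorem relabelFun_apply (α : X ≃o X) (f : FI X K) (x y : X) :
    (relabelFun α f).1 x y = f.1 (α.symm x) (α.symm y) := rfl

theorem relabelFun_diag (α : X ≃o X) (d : X → K) :
    relabelFun α (diag d) = diag fun x => d (α.symm x) := by
  classical
  apply FI.ext'
  intro x y _
  rw [relabelFun_apply, diag_apply, diag_apply]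
  simp

variable (K) in
/-- The automorphism `f ↦ ((x, y) ↦ f (α⁻¹ x) (α⁻¹ y))`. -/
noncomputable def relabel (α : X ≃o X) : FI X K ≃ₐ[K] FI X K where
  toFun := relabelFun α
  invFun := relabelFun α.symm
  left_inv f := FI.ext' fun x y _ => by simp [relabelFun_apply]
  right_inv f := FI.ext' fun x y _ => by simp [relabelFun_apply]
  map_mul' f g := FI.ext' fun x y _ => by
    classical
    rw [relabelFun_apply, FI.mul_apply_left f g _ _ _ le_rfl,
      FI.mul_apply_eq_sum (relabelFun α f) _ x y
        ((f.finite_left (α.symm x) (α.symm y)).toFinset.image α),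
      Finset.sum_image fun a _ b _ e => α.injective e]
    · simp [relabelFun_apply]
    · intro z _ h2 h3 _
      rw [Finset.mem_image]
      refine ⟨α.symm z, ?_, α.apply_symm_apply z⟩
      rw [Set.Finite.mem_toFinset]
      exact ⟨α.symm.monotone h2, h3⟩
  map_add' f g := FI.ext' fun x y _ => rfl
  commutes' k := by
    rw [Algebra.algebraMap_eq_smul_one]
    exact congrArg (k • ·) (relabelFun_diag α fun _ => (1 : K))

theorem relabel_apply (α : X ≃o X) (f : FI X K) (x y : X) :
    (relabel K α f).1 x y = f.1 (α.symm x) (α.symm y) := rfl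

/-! ### Straightening the images of the diagonal idempotents -/

/-- A map moving every point of an infinite set `B` moves infinitely many of them across some
subset. -/
theorem exists_separating_set {Y : Type*} {B : Set Y} (hB : B.Infinite) (a : Y → Y)
    (ha : ∀ b ∈ B, a b ≠ b) : ∃ S : Set Y, {b ∈ B | ¬ (b ∈ S ↔ a b ∈ S)}.Infinite := by
  classical
  -- An infinite fibre over `c` is separated by `{c}`. If all fibres are finite, a sequence in `B`
  -- is chosen greedily so that `a` maps no term to another term; its range then contains every term
  -- but none of their images.
  by_cases hfib : ∃ c, {b ∈ B | a b = c}.Infinite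
  · obtain ⟨c, hc⟩ := hfib
    refine ⟨{c}, hc.mono ?_⟩
    rintro b ⟨hb, rfl⟩
    exact ⟨hb, fun h => ha b hb (h.2 rfl).symm⟩
  · push Not at hfib
    obtain ⟨f, hfB, hf⟩ := exists_seq_of_forall_finset_exists (fun b => b ∈ B)
      (fun x y => x ≠ y ∧ a x ≠ y ∧ a y ≠ x) (fun s _ => by
        have hfin : ((s : Set Y) ∪ a '' s ∪ ⋃ c ∈ s, {b ∈ B | a b = c}).Finite :=
          (s.finite_toSet.union (s.finite_toSet.image a)).union
            (s.finite_toSet.biUnion fun c _ => hfib c)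
        obtain ⟨y, hyB, hy⟩ := (hB.sdiff hfin).nonempty
        refine ⟨y, hyB, fun x hx => ⟨?_, ?_, ?_⟩⟩
        · rintro rfl
          exact hy (Or.inl (Or.inl hx))
        · intro h
          exact hy (Or.inl (Or.inr ⟨x, hx, h⟩))
        · intro h
          exact hy (Or.inr (Set.mem_biUnion (x := x) hx ⟨hyB, h⟩)))
    have hinj : Function.Injective f := by
      intro m n h
      rcases lt_trichotomy m n with h' | h' | h'
      · exact absurd h (hf m n h').1
      · exact h'
      · exact absurd h.symm (hf n m h').1
    refine ⟨Set.range f, (Set.infinite_range_of_injective hinj).mono ?_⟩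
    rintro _ ⟨n, rfl⟩
    refine ⟨hfB n, fun h => ?_⟩
    obtain ⟨m, hm⟩ := h.1 ⟨n, rfl⟩
    rcases lt_trichotomy m n with h' | h' | h'
    · exact (hf m n h').2.2 hm.symm
    · subst h'
      exact ha _ (hfB m) hm.symm
    · exact (hf n m h').2.1 hm.symm

section Straighten

variable (Φ : FI X K ≃ₐ[K] FI X K)

theorem map_diag_mul_map_pointIdem (d : X → K) (b : X) :
    Φ (diag d) * Φ (pointIdem K b) = d b • Φ (pointIdem K b) := by
  classical
  rw [← map_mul, ← map_smul]
  congr 1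
  apply FI.ext'
  intro x y _
  rw [mul_pointIdem_apply, FI.smul_apply, pointIdem_apply, diag_apply]
  by_cases hxy : x = y
  · subst hxy
    by_cases hxb : x = b <;> simp [hxb]
  · simp [hxy]

theorem map_pointIdem_mul_map_diag (d : X → K) (b : X) :
    Φ (pointIdem K b) * Φ (diag d) = d b • Φ (pointIdem K b) := by
  classical
  rw [← map_mul, ← map_smul]
  congr 1
  apply FI.ext'
  intro x y _
  rw [pointIdem_mul_apply, FI.smul_apply, pointIdem_apply, diag_apply]
  by_cases hxb : x = b <;> simp [hxb]

open Classical in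
theorem map_pointIdem_mul_map_pointIdem (x y : X) :
    Φ (pointIdem K x) * Φ (pointIdem K y) = if x = y then Φ (pointIdem K x) else 0 := by
  rw [← map_mul, pointIdem_mul_pointIdem, apply_ite Φ, map_zero]

variable {Φ}

theorem map_diag_apply_self (hΦ : ∀ x, (Φ (pointIdem K x)).1 x x = 1) (d : X → K) (x : X) :
    (Φ (diag d)).1 x x = d x := by
  have h := congrArg (fun f : FI X K => f.1 x x) (map_diag_mul_map_pointIdem Φ d x)
  simpa [FI.mul_apply_self, FI.smul_apply, hΦ x] using h

/-- Compare entries at `(a, b)` in `Φ(d) Φ(e_b) = d(b) Φ(e_b)`. Column `b` vanishes strictly between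
`a` and `b`, so only the two end terms survive. -/
theorem map_diag_apply_of_maximal (hΦ : ∀ x, (Φ (pointIdem K x)).1 x x = 1) (d : X → K)
    {a b : X} (hab : a < b) (hmax : ∀ c, a < c → c < b → (Φ (pointIdem K b)).1 c b = 0) :
    (Φ (diag d)).1 a b = (d b - d a) * (Φ (pointIdem K b)).1 a b := by
  classical
  have h := congrArg (fun f : FI X K => f.1 a b) (map_diag_mul_map_pointIdem Φ d b)
  simp only [FI.smul_apply] at h
  rw [FI.mul_apply_eq_sum _ _ a b {a, b}, Finset.sum_pair hab.ne, map_diag_apply_self hΦ, hΦ,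
    mul_one] at h
  · linear_combination h
  · intro c h1 h2 _ h3
    rw [Finset.mem_insert, Finset.mem_singleton]
    by_contra! hn
    exact h3 (hmax c (lt_of_le_of_ne h1 hn.1.symm) (lt_of_le_of_ne h2 hn.2))

theorem map_diag_apply_of_minimal (hΦ : ∀ x, (Φ (pointIdem K x)).1 x x = 1) (d : X → K)
    {a b : X} (hab : a < b) (hmin : ∀ c, a < c → c < b → (Φ (pointIdem K a)).1 a c = 0) :
    (Φ (diag d)).1 a b = (d a - d b) * (Φ (pointIdem K a)).1 a b := by
  classical
  have h := congrArg (fun f : FI X K => f.1 a b) (map_pointIdem_mul_map_diag Φ d a)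
  simp only [FI.smul_apply] at h
  rw [FI.mul_apply_eq_sum _ _ a b {a, b}, Finset.sum_pair hab.ne, map_diag_apply_self hΦ, hΦ,
    one_mul] at h
  · linear_combination h
  · intro c h1 h2 h3 _
    rw [Finset.mem_insert, Finset.mem_singleton]
    by_contra! hn
    exact h3 (hmin c (lt_of_le_of_ne h1 hn.1.symm) (lt_of_le_of_ne h2 hn.2))

/-- Each column is finite, so an infinite set would meet infinitely many columns `b`. Take a maximal
row `a b` in each. If `S` separates `b` from `a b` infinitely often, the image of the indicator of
`S` has infinitely many nonzero off-diagonal entries in `[x, y]`, a contradiction. -/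
theorem finite_columns (hΦ : ∀ x, (Φ (pointIdem K x)).1 x x = 1) (x y : X) :
    {p : X × X | x ≤ p.1 ∧ p.1 < p.2 ∧ p.2 ≤ y ∧ (Φ (pointIdem K p.2)).1 p.1 p.2 ≠ 0}.Finite := by
  classical
  set P := {p : X × X | x ≤ p.1 ∧ p.1 < p.2 ∧ p.2 ≤ y ∧
    (Φ (pointIdem K p.2)).1 p.1 p.2 ≠ 0}
  by_cases hB : (Prod.snd '' P).Finite
  · refine Set.Finite.subset (hB.biUnion fun b _ =>
      ((Φ (pointIdem K b)).finite_right x b).image fun a => (a, b)) ?_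
    rintro ⟨a, b⟩ hp
    exact Set.mem_biUnion ⟨(a, b), hp, rfl⟩ ⟨a, ⟨hp.1, hp.2.2.2⟩, rfl⟩
  exfalso
  have hex : ∀ b ∈ Prod.snd '' P, ∃ a, (a, b) ∈ P ∧
      ∀ c, a < c → c < b → (Φ (pointIdem K b)).1 c b = 0 := by
    rintro _ ⟨⟨a, b⟩, hp, rfl⟩
    have hfin : {a | (a, b) ∈ P}.Finite :=
      ((Φ (pointIdem K b)).finite_right x b).subset fun a ha => ⟨ha.1, ha.2.2.2⟩
    obtain ⟨m, hm⟩ := hfin.exists_maximal ⟨a, hp⟩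
    refine ⟨m, hm.prop, fun c h1 h2 => ?_⟩
    by_contra h3
    exact hm.not_prop_of_gt h1 ⟨hm.prop.1.trans h1.le, h2, hm.prop.2.2.1, h3⟩
  choose! a ha hmax using hex
  obtain ⟨S, hS⟩ := exists_separating_set hB a fun b hb => (ha b hb).2.1.ne
  have hxy : x ≤ y := by
    obtain ⟨b, hb, _⟩ := hS.nonempty
    exact (ha b hb).1.trans ((ha b hb).2.1.le.trans (ha b hb).2.2.1)
  refine hS (((((Φ (diag fun z => if z ∈ S then (1 : K) else 0)).2 x y hxy)).image
    Prod.snd).subset ?_)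
  rintro b ⟨hb, hsep⟩
  refine ⟨(a b, b), ⟨(ha b hb).1, (ha b hb).2.1, (ha b hb).2.2.1, ?_⟩, rfl⟩
  rw [map_diag_apply_of_maximal hΦ _ (ha b hb).2.1 (hmax b hb)]
  refine mul_ne_zero ?_ (ha b hb).2.2.2
  by_cases h1 : b ∈ S <;> by_cases h2 : a b ∈ S <;> simp [h1, h2] at hsep ⊢

/-- The dual of `finite_columns`, with minimal columns in place of maximal rows. -/
theorem finite_rows (hΦ : ∀ x, (Φ (pointIdem K x)).1 x x = 1) (x y : X) :
    {p : X × X | x ≤ p.1 ∧ p.1 < p.2 ∧ p.2 ≤ y ∧ (Φ (pointIdem K p.1)).1 p.1 p.2 ≠ 0}.Finite := by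
  classical
  set P := {p : X × X | x ≤ p.1 ∧ p.1 < p.2 ∧ p.2 ≤ y ∧
    (Φ (pointIdem K p.1)).1 p.1 p.2 ≠ 0}
  by_cases hB : (Prod.fst '' P).Finite
  · refine Set.Finite.subset (hB.biUnion fun a _ =>
      ((Φ (pointIdem K a)).finite_left a y).image fun b => (a, b)) ?_
    rintro ⟨a, b⟩ hp
    exact Set.mem_biUnion ⟨(a, b), hp, rfl⟩ ⟨b, ⟨hp.2.2.1, hp.2.2.2⟩, rfl⟩
  exfalso
  have hex : ∀ a ∈ Prod.fst '' P, ∃ b, (a, b) ∈ P ∧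
      ∀ c, a < c → c < b → (Φ (pointIdem K a)).1 a c = 0 := by
    rintro _ ⟨⟨a, b⟩, hp, rfl⟩
    have hfin : {b | (a, b) ∈ P}.Finite :=
      ((Φ (pointIdem K a)).finite_left a y).subset fun b hb => ⟨hb.2.2.1, hb.2.2.2⟩
    obtain ⟨m, hm⟩ := hfin.exists_minimal ⟨b, hp⟩
    refine ⟨m, hm.prop, fun c h1 h2 => ?_⟩
    by_contra h3
    exact hm.not_prop_of_lt h2 ⟨hm.prop.1, h1, h2.le.trans hm.prop.2.2.1, h3⟩
  choose! b hb hmin using hex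
  obtain ⟨S, hS⟩ := exists_separating_set hB b fun a ha => (hb a ha).2.1.ne'
  have hxy : x ≤ y := by
    obtain ⟨a, ha, _⟩ := hS.nonempty
    exact (hb a ha).1.trans ((hb a ha).2.1.le.trans (hb a ha).2.2.1)
  refine hS (((((Φ (diag fun z => if z ∈ S then (1 : K) else 0)).2 x y hxy)).image
    Prod.fst).subset ?_)
  rintro a ⟨ha, hsep⟩
  refine ⟨(a, b a), ⟨(hb a ha).1, (hb a ha).2.1, (hb a ha).2.2.1, ?_⟩, rfl⟩
  rw [map_diag_apply_of_minimal hΦ _ (hb a ha).2.1 (hmin a ha)]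
  refine mul_ne_zero ?_ (hb a ha).2.2.2
  by_cases h1 : a ∈ S <;> by_cases h2 : b a ∈ S <;> simp [h1, h2] at hsep ⊢

/-- The element whose column at `b` is that of `Φ (pointIdem K b)`. -/
noncomputable def columnElt (hΦ : ∀ x, (Φ (pointIdem K x)).1 x x = 1) : FI X K :=
  ⟨⟨fun a b => (Φ (pointIdem K b)).1 a b, fun _ _ h => FI.eq_zero _ h⟩,
    fun x y _ => finite_columns hΦ x y⟩

/-- The element whose row at `a` is that of `Φ (pointIdem K a)`. -/
noncomputable def rowElt (hΦ : ∀ x, (Φ (pointIdem K x)).1 x x = 1) : FI X K :=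
  ⟨⟨fun a b => (Φ (pointIdem K a)).1 a b, fun _ _ h => FI.eq_zero _ h⟩,
    fun x y _ => finite_rows hΦ x y⟩

/-- Column `b` of a product depends only on column `b` of the right factor, which is here that of `Φ
(pointIdem K b)`; orthogonality of the images does the rest. -/
theorem map_pointIdem_mul_columnElt (hΦ : ∀ x, (Φ (pointIdem K x)).1 x x = 1) (x : X) :
    Φ (pointIdem K x) * columnElt hΦ = columnElt hΦ * pointIdem K x := by
  classical
  apply FI.ext'
  intro a b _
  rw [mul_pointIdem_apply]
  calc (Φ (pointIdem K x) * columnElt hΦ).1 a b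
      = (Φ (pointIdem K x) * Φ (pointIdem K b)).1 a b := rfl
    _ = _ := by
      rw [map_pointIdem_mul_map_pointIdem]
      by_cases h : x = b
      · subst h
        rw [if_pos rfl, if_pos rfl]
        rfl
      · rw [if_neg h, if_neg (Ne.symm h), FI.zero_apply]

theorem rowElt_mul_columnElt (hΦ : ∀ x, (Φ (pointIdem K x)).1 x x = 1) :
    rowElt hΦ * columnElt hΦ = 1 := by
  classical
  apply FI.ext'
  intro a b _
  calc (rowElt hΦ * columnElt hΦ).1 a b
      = (Φ (pointIdem K a) * Φ (pointIdem K b)).1 a b := rfl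
    _ = _ := by
      rw [map_pointIdem_mul_map_pointIdem, FI.one_apply]
      by_cases h : a = b
      · subst h
        rw [if_pos rfl, if_pos rfl, hΦ]
      · rw [if_neg h, if_neg h, FI.zero_apply]

/-- The one-sided inverse makes `columnElt hΦ * rowElt hΦ` idempotent with diagonal 1, so its
complement is an idempotent with zero diagonal. -/
theorem columnElt_mul_rowElt (hΦ : ∀ x, (Φ (pointIdem K x)).1 x x = 1) :
    columnElt hΦ * rowElt hΦ = 1 := by
  have hw : columnElt hΦ * rowElt hΦ * (columnElt hΦ * rowElt hΦ) =
      columnElt hΦ * rowElt hΦ := by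
    rw [mul_assoc, ← mul_assoc (rowElt hΦ), rowElt_mul_columnElt, one_mul]
  have h0 : 1 - columnElt hΦ * rowElt hΦ = 0 := by
    refine eq_zero_of_idempotent ?_ fun x => ?_
    · rw [mul_sub, mul_one, sub_mul, one_mul, hw, sub_self, sub_zero]
    · rw [FI.sub_apply, FI.mul_apply_self,
        show (columnElt hΦ).1 x x = 1 from hΦ x, show (rowElt hΦ).1 x x = 1 from hΦ x]
      simp [FI.one_apply]
  exact (sub_eq_zero.1 h0).symm

/-- The unit conjugating `pointIdem K x` to `Φ (pointIdem K x)` for every `x`. -/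
noncomputable def columnUnit (hΦ : ∀ x, (Φ (pointIdem K x)).1 x x = 1) : (FI X K)ˣ where
  val := columnElt hΦ
  inv := rowElt hΦ
  val_inv := columnElt_mul_rowElt hΦ
  inv_val := rowElt_mul_columnElt hΦ

end Straighten

/-! ### Decomposition of automorphisms -/

/-- An automorphism fixing every diagonal idempotent is multiplicative. -/
theorem exists_eq_multAut (Θ : FI X K ≃ₐ[K] FI X K)
    (hΘ : ∀ x, Θ (pointIdem K x) = pointIdem K x) :
    ∃ (σ : IncidenceAlgebra K X) (hσ : IsMultiplicative σ), Θ = multAut σ hσ := by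
  have hunit : ∀ x y, x ≤ y →
      Θ (matUnit K x y) = (Θ (matUnit K x y)).1 x y • matUnit K x y := fun x y h => by
    conv_lhs => rw [← pointIdem_mul_matUnit_mul h, map_mul, map_mul, hΘ, hΘ, corner_eq]
  have hσ : IsMultiplicative (⟨fun x y => (Θ (matUnit K x y)).1 x y,
      fun x y h => FI.eq_zero _ h⟩ : IncidenceAlgebra K X) := by
    constructor
    · intro x y h h0
      change (Θ (matUnit K x y)).1 x y = 0 at h0
      have h1 := hunit x y h
      rw [h0, zero_smul, map_eq_zero_iff Θ Θ.injective] at h1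
      have h2 := matUnit_apply_of_le (K := K) h
      rw [h1, FI.zero_apply] at h2
      exact zero_ne_one h2
    · intro x y z hxy hyz
      change (Θ (matUnit K x y)).1 x y * (Θ (matUnit K y z)).1 y z = (Θ (matUnit K x z)).1 x z
      have h := congrArg (fun f : FI X K => f.1 x z)
        (congrArg Θ (matUnit_mul_matUnit (K := K) hxy hyz))
      simp only [map_mul] at h
      rw [hunit x y hxy, hunit y z hyz, smul_mul_smul_comm, matUnit_mul_matUnit hxy hyz,
        FI.smul_apply, matUnit_apply_of_le (hxy.trans hyz), mul_one] at h
      exact h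
  refine ⟨_, hσ, AlgEquiv.ext fun f => FI.ext' fun x y h => ?_⟩
  change (Θ f).1 x y = (Θ (matUnit K x y)).1 x y * f.1 x y
  -- Since `Θ` fixes the diagonal idempotents, it respects corners, so each entry of `Θ f` is
  -- computed from the same entry of `f`.
  have h1 := congrArg (fun g : FI X K => g.1 x y) (congrArg Θ (corner_eq f x y))
  simp only [map_mul, map_smul, hΘ] at h1
  rw [corner_eq, FI.smul_apply, FI.smul_apply, matUnit_apply_of_le h, mul_one] at h1
  rw [h1, mul_comm]

theorem innerAut_mul_apply {A : Type u} [Ring A] [Algebra K A] (u w : Aˣ) (a : A) :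
    innerAut K (u * w) a = innerAut K u (innerAut K w a) := by
  change ((u * w : Aˣ) : A) * a * (((u * w)⁻¹ : Aˣ) : A) =
    u * (w * a * ((w⁻¹ : Aˣ) : A)) * ((u⁻¹ : Aˣ) : A)
  simp [mul_assoc]

/-- If multiplicative automorphisms are inner, then so is every automorphism fixing the diagonal
idempotents modulo elements of zero diagonal. -/
theorem isInner_of_apply_self (hM : MultiplicativeAutsInner X K) (Φ : FI X K ≃ₐ[K] FI X K)
    (hΦ : ∀ x, (Φ (pointIdem K x)).1 x x = 1) : IsInner Φ := by
  set u := columnUnit hΦ with hu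
  -- Undoing conjugation by `u` leaves an automorphism that fixes every diagonal idempotent.
  obtain ⟨σ, hσ, h⟩ := exists_eq_multAut (Φ.trans (innerAut K u⁻¹)) fun x => by
    change ((u⁻¹ : (FI X K)ˣ) : FI X K) * Φ (pointIdem K x) * (((u⁻¹)⁻¹ : (FI X K)ˣ) : FI X K) = _
    rw [inv_inv, mul_assoc, show Φ (pointIdem K x) * (u : FI X K) = u * pointIdem K x from
      map_pointIdem_mul_columnElt hΦ x, Units.inv_mul_cancel_left]
  obtain ⟨w, hw⟩ := hM σ hσ
  refine ⟨u * w, AlgEquiv.ext fun f => ?_⟩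
  rw [innerAut_mul_apply, ← hw, ← h]
  change Φ f = innerAut K u (innerAut K u⁻¹ (Φ f))
  rw [← innerAut_mul_apply, mul_inv_cancel]
  change Φ f = ((1 : (FI X K)ˣ) : FI X K) * Φ f * (((1 : (FI X K)ˣ)⁻¹ : (FI X K)ˣ) : FI X K)
  simp

/-- If multiplicative automorphisms are inner, then every automorphism becomes inner after
composition with an automorphism induced by the poset. -/
theorem exists_isInner_trans_relabel (hM : MultiplicativeAutsInner X K)
    (Φ : FI X K ≃ₐ[K] FI X K) : ∃ α : X ≃o X, IsInner (Φ.trans (relabel K α)) := by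
  refine ⟨(inducedIso Φ).symm, isInner_of_apply_self hM _ fun x => ?_⟩
  change (relabel K (inducedIso Φ).symm (Φ (pointIdem K x))).1 x x = 1
  rw [relabel_apply, map_pointIdem_apply_self]
  exact if_pos rfl

/-- Taking the diagonal entry at `x` is multiplicative with values in the commutative field `K`, so
conjugation is invisible there. -/
theorem IsInner.apply_self {Φ : FI X K ≃ₐ[K] FI X K} (h : IsInner Φ) (f : FI X K) (x : X) :
    (Φ f).1 x x = f.1 x x := by
  obtain ⟨u, rfl⟩ := h
  change ((u : FI X K) * f * ((u⁻¹ : (FI X K)ˣ) : FI X K)).1 x x = f.1 x x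
  have hu : (u : FI X K).1 x x * ((u⁻¹ : (FI X K)ˣ) : FI X K).1 x x = 1 := by
    rw [← FI.mul_apply_self, Units.mul_inv, FI.one_apply, if_pos rfl]
  rw [FI.mul_apply_self, FI.mul_apply_self]
  linear_combination f.1 x x * hu

/-! ### The involutions `ρ_ε` -/

theorem rhoEps_apply (s : RingInvo K) (l : PosetInvolution X)
    (ε : fixedSet l → (fixedSubfield s)ˣ) (f : FI X K) (x y : X) :
    (rhoEps s l ε f).unop.1 x y =
      epsDiag ε x * (s (f.1 (l y) (l x))).unop * (epsDiag ε y)⁻¹ := by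
  change (diag (epsDiag ε) * stdMap s l f * diag fun x => (epsDiag ε x)⁻¹).1 x y = _
  rw [mul_diag_apply, diag_mul_apply, stdMap_apply]

theorem rhoEps_apply_self (s : RingInvo K) (l : PosetInvolution X)
    (ε : fixedSet l → (fixedSubfield s)ˣ) (f : FI X K) (x : X) :
    (rhoEps s l ε f).unop.1 x x = (s (f.1 (l x) (l x))).unop := by
  rw [rhoEps_apply, mul_right_comm, mul_inv_cancel₀ (epsDiag_ne_zero ε x), one_mul]

theorem epsDiag_comp_symmOnFixed {s : RingInvo K} {l₁ l₂ : PosetInvolution X} (α : X ≃o X)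
    (hα : ∀ x, α (l₂ x) = l₁ (α x)) (ε : fixedSet l₂ → (fixedSubfield s)ˣ) (x : X) :
    epsDiag (ε ∘ symmOnFixed α hα) x = epsDiag ε (α.symm x) := by
  by_cases h : x ∈ fixedSet l₁
  · have h' : α.symm x ∈ fixedSet l₂ := (symmOnFixed α hα ⟨x, h⟩).2
    rw [epsDiag, epsDiag, dif_pos h, dif_pos h']
    rfl
  · have h' : α.symm x ∉ fixedSet l₂ := fun h' => h (by
      have e : l₂ (α.symm x) = α.symm x := h'
      have := hα (α.symm x)
      rw [e, α.apply_symm_apply] at this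
      exact this.symm)
    rw [epsDiag, epsDiag, dif_neg h, dif_neg h']

theorem symm_apply_involution {l₁ l₂ : PosetInvolution X} (α : X ≃o X)
    (hα : ∀ x, α (l₂ x) = l₁ (α x)) (x : X) : α.symm (l₁ x) = l₂ (α.symm x) := by
  rw [α.symm_apply_eq, hα, α.apply_symm_apply]

/-- The intertwining relation matches both the reflected positions and, through the fixed points,
the diagonal weights. -/
theorem relabel_rhoEps (s : RingInvo K) {l₁ l₂ : PosetInvolution X} (α : X ≃o X)
    (hα : ∀ x, α (l₂ x) = l₁ (α x)) (ε : fixedSet l₂ → (fixedSubfield s)ˣ) (f : FI X K) :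
    relabel K α (rhoEps s l₂ ε f).unop =
      (rhoEps s l₁ (ε ∘ symmOnFixed α hα) (relabel K α f)).unop := by
  apply FI.ext'
  intro x y _
  rw [relabel_apply, rhoEps_apply, rhoEps_apply, relabel_apply, epsDiag_comp_symmOnFixed,
    epsDiag_comp_symmOnFixed, symm_apply_involution α hα, symm_apply_involution α hα]

/-- Equivalent involutions `ρ_ε` restrict to the same involution on the scalars. -/
theorem Equivalent.scalar_eq [Nonempty X] {s₁ s₂ : RingInvo K} {l₁ l₂ : PosetInvolution X}
    {ε₁ : fixedSet l₁ → (fixedSubfield s₁)ˣ} {ε₂ : fixedSet l₂ → (fixedSubfield s₂)ˣ}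
    (h : Equivalent K (rhoEps s₁ l₁ ε₁) (rhoEps s₂ l₂ ε₂)) : s₁ = s₂ := by
  classical
  obtain ⟨Φ, hΦ⟩ := h
  -- Both involutions act on scalar multiples of 1 through `s`, while `Φ` fixes them by
  -- `K`-linearity.
  have hs : ∀ (s : RingInvo K) (l : PosetInvolution X) (ε : fixedSet l → (fixedSubfield s)ˣ)
      (k : K), (rhoEps s l ε (k • 1)).unop = (s k).unop • (1 : FI X K) := by
    intro s l ε k
    apply FI.ext'
    intro x y _
    rw [FI.smul_apply, FI.one_apply]
    split_ifs with hxy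
    · subst hxy
      rw [rhoEps_apply_self, FI.smul_apply, FI.one_apply, if_pos rfl]
      simp
    · have h' : l y ≠ l x := fun e => hxy (by
        have := congrArg l e
        rwa [l.apply_apply, l.apply_apply, eq_comm] at this)
      rw [rhoEps_apply, FI.smul_apply, FI.one_apply, if_neg h']
      simp
  refine DFunLike.ext _ _ fun k => MulOpposite.unop_injective ?_
  have h1 := hΦ (k • 1)
  rw [hs, map_smul, map_smul, map_one, hs] at h1
  obtain ⟨x⟩ := ‹Nonempty X›
  have h2 := congrArg (fun f : FI X K => f.1 x x) h1
  simpa [FI.smul_apply, FI.one_apply] using h2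

/-- If an inner automorphism followed by relabelling along `α⁻¹` intertwines two involutions `ρ_ε`,
then `α` intertwines the involutions of the poset. -/
theorem apply_involution_of_isInner {s₁ s₂ : RingInvo K} {l₁ l₂ : PosetInvolution X}
    {ε₁ : fixedSet l₁ → (fixedSubfield s₁)ˣ} {ε₂ : fixedSet l₂ → (fixedSubfield s₂)ˣ}
    {Φ : FI X K ≃ₐ[K] FI X K}
    (hΦ : ∀ f, Φ (rhoEps s₁ l₁ ε₁ f).unop = (rhoEps s₂ l₂ ε₂ (Φ f)).unop)
    {α : X ≃o X} (hα : IsInner (Φ.trans (relabel K α))) (x : X) : α (l₂ x) = l₁ (α x) := by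
  have hd : ∀ f z, (Φ f).1 z z = f.1 (α z) (α z) := fun f z => by
    rw [← hα.apply_self f (α z)]
    change _ = (relabel K α (Φ f)).1 (α z) (α z)
    rw [relabel_apply, α.symm_apply_apply]
  -- The test idempotent sits at `l₁ (α x)`: the left side then has entry 1 at `(x, x)`, whereas the
  -- right side has the image under `s₂` of its entry at `α (l₂ x)`, which is 0 unless the two
  -- points agree.
  have h := congrArg (fun f : FI X K => f.1 x x) (hΦ (pointIdem K (l₁ (α x))))
  simp only [rhoEps_apply_self, hd, pointIdem_apply_self] at h
  by_contra hn
  rw [pointIdem_apply, if_neg fun h' => hn h'.2] at h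
  simp at h

end FinInc

theorem theorem4p18 {X : Type*} [PartialOrder X] {K : Type*} [Field K]
    (hchar : ringChar K ≠ 2) (hX : PosetConnected X) (hM : MultiplicativeAutsInner X K)
    (l₁ l₂ : PosetInvolution X)
    (hcard : Cardinal.mk (fixedSet l₁) = Cardinal.mk (fixedSet l₂))
    (hone : 1 < Cardinal.mk (fixedSet l₁))
    (s₁ s₂ : RingInvo K) (hs₁ : IsSecondKind s₁) (hs₂ : IsSecondKind s₂)
    (ε₁ : fixedSet l₁ → (fixedSubfield s₁)ˣ) (ε₂ : fixedSet l₂ → (fixedSubfield s₂)ˣ)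
    (hne : ¬ InnerEquivalent K (rhoEps s₁ l₁ ε₁) (rhoEps s₂ l₂ ε₂)) :
    Equivalent K (rhoEps s₁ l₁ ε₁) (rhoEps s₂ l₂ ε₂) ↔
      s₁ = s₂ ∧ ∃ (α : X ≃o X) (hα : ∀ x, α (l₂ x) = l₁ (α x)),
        InnerEquivalent K (rhoEps s₁ l₁ ε₁) (rhoEps s₂ l₁ (ε₂ ∘ symmOnFixed α hα)) := by
  have hnonempty : Nonempty X := by
    have : Nonempty (fixedSet l₁) := Cardinal.mk_ne_zero_iff.1 (zero_lt_one.trans hone).ne'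
    exact this.map Subtype.val
  constructor
  · intro h
    refine ⟨h.scalar_eq, ?_⟩
    obtain ⟨Φ, hΦ⟩ := h
    obtain ⟨α, hα⟩ := exists_isInner_trans_relabel hM Φ
    refine ⟨α, apply_involution_of_isInner hΦ hα, _, hα, fun f => ?_⟩
    change relabel K α (Φ (rhoEps s₁ l₁ ε₁ f).unop) = _
    rw [hΦ, relabel_rhoEps s₂ α (apply_involution_of_isInner hΦ hα)]
    rfl
  · rintro ⟨_, α, hα, Ψ, _, hΨ⟩
    refine ⟨Ψ.trans (relabel K α).symm, fun f => (relabel K α).injective ?_⟩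
    rw [relabel_rhoEps s₂ α hα]
    change relabel K α ((relabel K α).symm (Ψ _)) =
      (rhoEps s₂ l₁ _ (relabel K α ((relabel K α).symm (Ψ f)))).unop
    rw [AlgEquiv.apply_symm_apply, AlgEquiv.apply_symm_apply, hΨ]
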